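/- Let $\mathbb N=\{1,2,\dots\}$. For $B\subset\mathbb N$, let $\mathcal F_B$ be the set of $n\in\mathbb N$ that have no divisor in $B$. A set $B\subset\mathbb N\setminus\{1\}$ is called Behrend if the natural density $\lim_{N\to\infty}\frac1N|\mathcal F_B\cap[1,N]|$ exists and equals $0$. A set $A\subset\mathbb N$ is primitive if no two distinct members of $A$ divide one another, and the primitive basis of $A$ is the set of those $a\in A$ that have no divisor in $A$ other than $a$ itself. Proposition. Let $B$ be a Behrend set (not necessarily primitive), and let $P=\{bc : b,c\in B,\ b\neq c\}$. Then the primitive basis of $P$ is primitive and Behrend. If moreover the elements of $B$ are pairwise coprime, then $P$ itself is primitive, and so coincides with its primitive basis (hence $P$ is Behrend). -/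

import Mathlib

open Filter Topology

/-- The positive integers that have no divisor in `B` (the `B`-free numbers). -/
def freeNumbers (B : Set ℕ) : Set ℕ :=
  {n | 0 < n ∧ ∀ b ∈ B, ¬ b ∣ n}

/-- The set `A` has natural density `d`: `|A ∩ [1, N]| / N` converges to `d`. -/
def HasNaturalDensity (A : Set ℕ) (d : ℝ) : Prop :=
  Tendsto (fun N : ℕ => ((A ∩ Set.Icc 1 N).ncard : ℝ) / (N : ℝ)) atTop (𝓝 d)

/-- A set of integers greater than `1` is Behrend if the natural density of the set of its
free numbers exists and equals zero. -/
structure IsBehrend (B : Set ℕ) : Prop where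
  one_lt : ∀ b ∈ B, 1 < b
  density_zero : HasNaturalDensity (freeNumbers B) 0

/-- No two distinct members of `A` divide one another. -/
def IsPrimitiveSet (A : Set ℕ) : Prop :=
  ∀ a ∈ A, ∀ b ∈ A, a ∣ b → a = b

/-- The primitive basis of `A`: the members of `A` that are minimal for divisibility. -/
def primitiveBasis (A : Set ℕ) : Set ℕ :=
  {a | a ∈ A ∧ ∀ b ∈ A, b ∣ a → b = a}

/-- The set of all products `b * c` of two different members of `B`. -/
def distinctProducts (B : Set ℕ) : Set ℕ :=
  {n | ∃ b ∈ B, ∃ c ∈ B, b ≠ c ∧ n = b * c}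

/-! Let `n` have no divisor in `P`. Either `n` has no divisor in `B` up to `K`, or `n = b * m` with
`b ∈ B`, `b ≤ K`, and then `m` has no divisor in `B \ {b}`. The second kind lies in finitely many
dilates of sets of density 0, because deleting one element keeps `B` Behrend
(`IsBehrend.diff_singleton`). The first kind has small density for large `K`
(`exists_truncation_density_lt`). The latter rests on `dirichletSum_mul_le`: for a divisor-closed
set, the ratio of its Dirichlet series to zeta is nondecreasing in `s`, so its value at any `s > 1`
bounds the density, when that exists. At a fixed `s` the series of the truncations converge to that
of `B`. Passing to the primitive basis does not change the free numbers. -/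

open scoped ENNReal

/-! ### Dirichlet series of divisor-closed sets -/

open ArithmeticFunction in
/-- For `ε ≥ 0` the function `n ↦ n ^ ε` is a divisor sum of a nonnegative function. -/
theorem exists_nonneg_sum_divisors_eq_rpow {ε : ℝ} (hε : 0 ≤ ε) :
    ∃ J : ℕ → ℝ, (∀ n, 0 ≤ J n) ∧
      ∀ n : ℕ, n ≠ 0 → ∑ x ∈ n.divisorsAntidiagonal, J x.1 = (n : ℝ) ^ ε := by
  -- The value at 0 is forced to be 0, since `0 ^ ε = 1` when `ε = 0`.
  let f : ArithmeticFunction ℝ := ⟨fun n => if n = 0 then 0 else (n : ℝ) ^ ε, by simp⟩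
  have hf0 : ∀ n : ℕ, n ≠ 0 → f n = (n : ℝ) ^ ε := fun n hn => by simp [f, hn]
  have hf : f.IsMultiplicative := by
    rw [IsMultiplicative.iff_ne_zero]
    refine ⟨by simp [f], fun {m n} hm hn _ => ?_⟩
    rw [hf0 _ hm, hf0 _ hn, hf0 _ (mul_ne_zero hm hn), Nat.cast_mul,
      Real.mul_rpow (Nat.cast_nonneg _) (Nat.cast_nonneg _)]
  let J : ArithmeticFunction ℝ := (moebius : ArithmeticFunction ℝ) * f
  have hJ : J.IsMultiplicative := isMultiplicative_moebius.intCast.mul hf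
  have hJζ : J * (zeta : ArithmeticFunction ℝ) = f := by
    simp only [J]
    rw [mul_comm, ← mul_assoc, coe_zeta_mul_coe_moebius, one_mul]
  have hsum : ∀ n : ℕ, n ≠ 0 → ∑ d ∈ n.divisors, J d = (n : ℝ) ^ ε := fun n hn => by
    rw [← hf0 n hn, ← hJζ, coe_mul_zeta_apply]
  refine ⟨J, fun n => ?_, fun n hn => ?_⟩
  · rcases eq_or_ne n 0 with rfl | hn
    · simp
    -- By multiplicativity only prime powers matter, and there `J` is a difference of consecutive
    -- values of an increasing function.
    rw [hJ.multiplicative_factorization J hn]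
    refine Finset.prod_nonneg fun p hp => ?_
    have hp' : p.Prime := Nat.prime_of_mem_primeFactors hp
    rcases n.factorization p with _ | k
    · simp [hJ.1]
    have h1 := hsum (p ^ k) (pow_ne_zero _ hp'.ne_zero)
    have h2 := hsum (p ^ (k + 1)) (pow_ne_zero _ hp'.ne_zero)
    rw [Nat.sum_divisors_prime_pow hp'] at h1 h2
    rw [Finset.sum_range_succ, h1] at h2
    have h3 : ((p ^ k : ℕ) : ℝ) ^ ε ≤ ((p ^ (k + 1) : ℕ) : ℝ) ^ ε := by
      refine Real.rpow_le_rpow (Nat.cast_nonneg _) ?_ hε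
      exact_mod_cast Nat.pow_le_pow_right hp'.pos k.le_succ
    linarith
  · rw [← hsum n hn, Nat.sum_divisorsAntidiagonal (fun d _ => J d)]

/-- The Dirichlet series of the indicator function of `A`, at a real point. -/
noncomputable def dirichletSum (A : Set ℕ) (s : ℝ) : ℝ :=
  ∑' n : ℕ, A.indicator (fun n : ℕ => (n : ℝ) ^ (-s)) n

theorem indicator_rpow_nonneg (A : Set ℕ) (s : ℝ) (n : ℕ) :
    0 ≤ A.indicator (fun n : ℕ => (n : ℝ) ^ (-s)) n :=
  Set.indicator_nonneg (fun _ _ => by positivity) _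

theorem summable_indicator_rpow (A : Set ℕ) {s : ℝ} (hs : 1 < s) :
    Summable (A.indicator (fun n : ℕ => (n : ℝ) ^ (-s))) :=
  (Real.summable_nat_rpow.2 (by linarith)).indicator A

theorem dirichletSum_nonneg (A : Set ℕ) (s : ℝ) : 0 ≤ dirichletSum A s :=
  tsum_nonneg (indicator_rpow_nonneg A s)

open Classical in
theorem ofReal_dirichletSum (A : Set ℕ) {s : ℝ} (hs : 1 < s) :
    ENNReal.ofReal (dirichletSum A s) =
      ∑' n : ℕ+, if (n : ℕ) ∈ A then ENNReal.ofReal (((n : ℕ) : ℝ) ^ (-s)) else 0 := by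
  rw [dirichletSum, ENNReal.ofReal_tsum_of_nonneg (indicator_rpow_nonneg A s)
    (summable_indicator_rpow A hs), ← PNat.coe_injective.tsum_eq]
  · refine tsum_congr fun n => ?_
    by_cases h : (n : ℕ) ∈ A <;> simp [h]
  · intro n hn
    refine ⟨⟨n, Nat.pos_of_ne_zero ?_⟩, rfl⟩
    rintro rfl
    have : (0 : ℝ) ^ (-s) = 0 := Real.zero_rpow (by linarith)
    by_cases h : 0 ∈ A <;> simp [h, this] at hn

/-- For a set `F` closed under divisors, the Dirichlet series of `F` divided by the zeta function
is monotone on the real half-line `s > 1`. -/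
theorem dirichletSum_mul_le {F : Set ℕ} (hF : ∀ n ∈ F, ∀ d, d ∣ n → d ∈ F) {s t : ℝ}
    (ht : 1 < t) (hts : t ≤ s) :
    dirichletSum F t * dirichletSum Set.univ s ≤ dirichletSum F s * dirichletSum Set.univ t := by
  classical
  have hs : 1 < s := ht.trans_le hts
  obtain ⟨J, hJ0, hJ⟩ := exists_nonneg_sum_divisors_eq_rpow (sub_nonneg.2 hts)
  -- Working in `ℝ≥0∞` lets the sums be rearranged with no summability condition on `J`.
  let w : ℕ → ℝ≥0∞ := fun n => ENNReal.ofReal ((n : ℝ) ^ (-s))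
  have hw : ∀ a b : ℕ, w (a * b) = w a * w b := fun a b => by
    simp only [w]
    rw [Nat.cast_mul, Real.mul_rpow (Nat.cast_nonneg _) (Nat.cast_nonneg _),
      ENNReal.ofReal_mul (by positivity)]
  -- Write `n ^ (-t) = n ^ (s - t) * n ^ (-s)` and expand the first factor over `n = b * a`.
  have key : ∀ A : Set ℕ, ENNReal.ofReal (dirichletSum A t) =
      ∑' b : ℕ+, ∑' a : ℕ+, ENNReal.ofReal (J b) * w b * (if (b * a : ℕ) ∈ A then w a else 0) := by
    intro A
    rw [ofReal_dirichletSum A ht, ← ENNReal.tsum_prod, ← sigmaAntidiagonalEquivProd.tsum_eq,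
      ENNReal.tsum_sigma']
    refine tsum_congr fun n => ?_
    have h1 : ENNReal.ofReal (((n : ℕ) : ℝ) ^ (-t)) =
        ∑ x ∈ (n : ℕ).divisorsAntidiagonal, ENNReal.ofReal (J x.1) * w n := by
      rw [← Finset.sum_mul, ← ENNReal.ofReal_sum_of_nonneg (fun _ _ => hJ0 _), hJ _ n.ne_zero,
        ← ENNReal.ofReal_mul (by positivity), ← Real.rpow_add (by exact_mod_cast n.pos)]
      congr 2
      ring
    rw [tsum_fintype, h1]
    rw [← Finset.sum_coe_sort]
    by_cases h : (n : ℕ) ∈ A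
    · rw [if_pos h]
      refine Finset.sum_congr rfl fun x _ => ?_
      have hx := (Nat.mem_divisorsAntidiagonal.1 x.2).1
      simp [sigmaAntidiagonalEquivProd, divisorsAntidiagonalFactors, hx, h, mul_assoc, ← hw]
    · rw [if_neg h]
      symm
      refine Finset.sum_eq_zero fun x _ => ?_
      have hx := (Nat.mem_divisorsAntidiagonal.1 x.2).1
      simp [sigmaAntidiagonalEquivProd, divisorsAntidiagonalFactors, hx, h]
  have h1 : ENNReal.ofReal (dirichletSum F t) ≤
      (∑' b : ℕ+, ENNReal.ofReal (J b) * w b) * ENNReal.ofReal (dirichletSum F s) := by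
    rw [key F, ofReal_dirichletSum F hs, ← ENNReal.tsum_mul_right]
    refine ENNReal.tsum_le_tsum fun b => ?_
    rw [ENNReal.tsum_mul_left]
    -- Closure under divisors enters here: `b * a ∈ F` forces `a ∈ F`. For the full set equality
    -- holds instead.
    gcongr with a
    split_ifs with h h'
    · exact le_rfl
    · exact absurd (hF _ h _ (dvd_mul_left _ _)) h'
    · exact zero_le
    · exact le_rfl
  have h2 : ENNReal.ofReal (dirichletSum Set.univ t) =
      (∑' b : ℕ+, ENNReal.ofReal (J b) * w b) * ENNReal.ofReal (dirichletSum Set.univ s) := by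
    rw [key, ofReal_dirichletSum _ hs, ← ENNReal.tsum_mul_right]
    refine tsum_congr fun b => ?_
    rw [ENNReal.tsum_mul_left]
    simp [w]
  have h3 : ENNReal.ofReal (dirichletSum F t * dirichletSum Set.univ s) ≤
      ENNReal.ofReal (dirichletSum F s * dirichletSum Set.univ t) := by
    rw [ENNReal.ofReal_mul (dirichletSum_nonneg _ _), ENNReal.ofReal_mul (dirichletSum_nonneg _ _),
      h2, ← mul_assoc, mul_comm (ENNReal.ofReal (dirichletSum F s))]
    gcongr
  exact (ENNReal.ofReal_le_ofReal_iff
    (mul_nonneg (dirichletSum_nonneg _ _) (dirichletSum_nonneg _ _))).1 h3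

/-! ### Natural density and Dirichlet density -/

theorem sum_indicator_Icc_eq_ncard (A : Set ℕ) (N : ℕ) :
    ∑ k ∈ Finset.Icc 1 N, A.indicator (fun _ => (1 : ℝ)) k = ((A ∩ Set.Icc 1 N).ncard : ℝ) := by
  classical
  have h : A ∩ Set.Icc 1 N = ((Finset.Icc 1 N).filter (· ∈ A) : Finset ℕ) := by
    ext n
    simp only [Set.mem_inter_iff, Set.mem_Icc, Finset.coe_filter, Finset.mem_Icc, Set.mem_ofPred_eq]
    exact and_comm
  rw [h, Set.ncard_coe_finset, Finset.card_filter, Nat.cast_sum]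
  exact Finset.sum_congr rfl fun k _ => by by_cases hk : k ∈ A <;> simp [hk]

/-- The Abelian theorem: a set of natural density `d` has Dirichlet density `d`. -/
theorem HasNaturalDensity.tendsto_sub_mul_dirichletSum {A : Set ℕ} {d : ℝ}
    (h : HasNaturalDensity A d) :
    Tendsto (fun s : ℝ => (s - 1) * dirichletSum A s) (𝓝[>] 1) (𝓝 d) := by
  have key := LSeries_tendsto_sub_mul_nhds_one_of_tendsto_sum_div_and_nonneg
    (A.indicator fun _ => (1 : ℝ)) (l := d)
    (h.congr fun N => by rw [sum_indicator_Icc_eq_ncard])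
    (Set.indicator_nonneg fun _ _ => zero_le_one)
  rw [← tendsto_ofReal_iff]
  refine key.congr' ?_
  filter_upwards [self_mem_nhdsWithin] with s hs
  have hs0 : s ≠ 0 := (zero_lt_one.trans hs).ne'
  push_cast [dirichletSum]
  rw [LSeries]
  congr 1
  refine tsum_congr fun n => ?_
  rcases eq_or_ne n 0 with rfl | hn
  · by_cases hA : 0 ∈ A <;> simp [hA, hs0]
  · rw [LSeries.term_of_ne_zero hn]
    by_cases hA : n ∈ A
    · simp [hA, Complex.ofReal_cpow, Complex.cpow_neg]
    · simp [hA]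

/-! ### Sets of density zero -/

theorem ncard_inter_Icc_le (A : Set ℕ) (N : ℕ) : (A ∩ Set.Icc 1 N).ncard ≤ N := by
  calc (A ∩ Set.Icc 1 N).ncard ≤ (Set.Icc 1 N).ncard :=
        Set.ncard_le_ncard Set.inter_subset_right (Set.finite_Icc _ _)
    _ = N := by simp [← Finset.coe_Icc, Set.ncard_coe_finset]

theorem ncard_inter_Icc_mono {A A' : Set ℕ} (h : A ⊆ A') (N : ℕ) :
    (A ∩ Set.Icc 1 N).ncard ≤ (A' ∩ Set.Icc 1 N).ncard :=
  Set.ncard_le_ncard (Set.inter_subset_inter_left _ h) ((Set.finite_Icc _ _).inter_of_right _)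

theorem ncard_union_inter_Icc_le (A A' : Set ℕ) (N : ℕ) :
    ((A ∪ A') ∩ Set.Icc 1 N).ncard ≤ (A ∩ Set.Icc 1 N).ncard + (A' ∩ Set.Icc 1 N).ncard := by
  rw [Set.union_inter_distrib_right]
  exact Set.ncard_union_le _ _

theorem ncard_image_mul_inter_Icc_le (A : Set ℕ) {b : ℕ} (hb : 0 < b) (N : ℕ) :
    (((b * ·) '' A) ∩ Set.Icc 1 N).ncard ≤ (A ∩ Set.Icc 1 (N / b)).ncard := by
  have h : ((b * ·) '' A) ∩ Set.Icc 1 N ⊆ (b * ·) '' (A ∩ Set.Icc 1 (N / b)) := by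
    rintro _ ⟨⟨m, hm, rfl⟩, h1, h2⟩
    refine ⟨m, ⟨hm, Nat.pos_of_mul_pos_left h1, ?_⟩, rfl⟩
    rw [Nat.le_div_iff_mul_le hb, mul_comm]
    exact h2
  have hfin := (Set.finite_Icc 1 (N / b)).inter_of_right A
  exact (Set.ncard_le_ncard h (hfin.image _)).trans (Set.ncard_image_le hfin)

theorem hasNaturalDensity_zero_iff {A : Set ℕ} :
    HasNaturalDensity A 0 ↔
      ∀ ε : ℝ, 0 < ε → ∀ᶠ N : ℕ in atTop, ((A ∩ Set.Icc 1 N).ncard : ℝ) ≤ ε * N := by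
  constructor
  · intro h ε hε
    filter_upwards [h.eventually_lt_const hε, eventually_gt_atTop 0] with N hN h0
    exact ((div_lt_iff₀ (by exact_mod_cast h0)).1 hN).le
  · intro h
    rw [HasNaturalDensity, tendsto_order]
    refine ⟨fun a ha => .of_forall fun N => ha.trans_le (by positivity), fun a ha => ?_⟩
    filter_upwards [h (a / 2) (by linarith), eventually_gt_atTop 0] with N hN h0
    rw [div_lt_iff₀ (by exact_mod_cast h0)]
    have : (0 : ℝ) < N := by exact_mod_cast h0
    nlinarith

theorem HasNaturalDensity.zero_union {A A' : Set ℕ} (h : HasNaturalDensity A 0)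
    (h' : HasNaturalDensity A' 0) : HasNaturalDensity (A ∪ A') 0 := by
  rw [hasNaturalDensity_zero_iff] at h h' ⊢
  intro ε hε
  filter_upwards [h (ε / 2) (half_pos hε), h' (ε / 2) (half_pos hε)] with N h1 h2
  have : (((A ∪ A') ∩ Set.Icc 1 N).ncard : ℝ) ≤
      (A ∩ Set.Icc 1 N).ncard + (A' ∩ Set.Icc 1 N).ncard := by
    exact_mod_cast ncard_union_inter_Icc_le A A' N
  linarith

theorem hasNaturalDensity_empty : HasNaturalDensity ∅ 0 := by
  simp [HasNaturalDensity]

theorem hasNaturalDensity_zero_biUnion {ι : Type*} {S : Set ι} (hS : S.Finite) {A : ι → Set ℕ}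
    (h : ∀ i ∈ S, HasNaturalDensity (A i) 0) : HasNaturalDensity (⋃ i ∈ S, A i) 0 := by
  induction S, hS using Set.Finite.induction_on with
  | empty => simpa using hasNaturalDensity_empty
  | insert _ _ ih =>
    rw [Set.biUnion_insert]
    exact (h _ (Set.mem_insert _ _)).zero_union (ih fun i hi => h i (Set.mem_insert_of_mem _ hi))

theorem HasNaturalDensity.zero_image_mul {A : Set ℕ} (h : HasNaturalDensity A 0) {b : ℕ}
    (hb : 0 < b) : HasNaturalDensity ((b * ·) '' A) 0 := by
  rw [hasNaturalDensity_zero_iff] at h ⊢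
  intro ε hε
  filter_upwards [h ε hε] with N hN
  have h1 : (((b * ·) '' A ∩ Set.Icc 1 N).ncard : ℝ) ≤ (A ∩ Set.Icc 1 N).ncard := by
    refine Nat.cast_le.2 ((ncard_image_mul_inter_Icc_le A hb N).trans ?_)
    refine Set.ncard_le_ncard (Set.inter_subset_inter_right _ ?_)
      ((Set.finite_Icc _ _).inter_of_right _)
    exact Set.Icc_subset_Icc_right (Nat.div_le_self _ _)
  exact h1.trans hN

/-! ### Periodic sets and finitely generated free numbers -/

/-- A set of positive integers whose membership is periodic has a natural density. -/
theorem exists_hasNaturalDensity_of_periodic {A : Set ℕ} {m : ℕ} (hm : 0 < m)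
    (hA : ∀ n, 0 < n → (m + n ∈ A ↔ n ∈ A)) : ∃ d, HasNaturalDensity A d := by
  classical
  -- The shift by 1 makes `c N` count over `[1, N]` and avoids 0, where periodicity is not assumed.
  let c : ℕ → ℕ := Nat.count fun n => n + 1 ∈ A
  have hc : ∀ N, (A ∩ Set.Icc 1 N).ncard = c N := by
    intro N
    have h : A ∩ Set.Icc 1 N = (· + 1) '' {n | n < N ∧ n + 1 ∈ A} := by
      ext n
      constructor
      · rintro ⟨h1, h2, h3⟩
        exact ⟨n - 1, ⟨by omega, by rwa [Nat.sub_add_cancel h2]⟩, Nat.sub_add_cancel h2⟩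
      · rintro ⟨k, ⟨h1, h2⟩, rfl⟩
        exact ⟨h2, by simp, h1⟩
    rw [h, Set.ncard_image_of_injective _ (add_left_injective 1)]
    simp only [c, Nat.count_eq_card_filter_range]
    rw [← Set.ncard_coe_finset]
    congr 1
    ext n
    simp
  have hstep : ∀ N, c (m + N) = c m + c N := by
    intro N
    simp only [c, Nat.count_add]
    congr 2
    ext k
    rw [add_assoc, hA _ k.succ_pos]
  have hmul : ∀ k r, c (m * k + r) = k * c m + c r := by
    intro k r
    induction k with
    | zero => simp
    | succ k ih => rw [mul_add, mul_one, add_comm (m * k), add_assoc, hstep, ih]; ring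
  have hle : ∀ N, c N ≤ N := fun N => hc N ▸ ncard_inter_Icc_le A N
  have hm' : (0 : ℝ) < m := by exact_mod_cast hm
  refine ⟨c m / m, ?_⟩
  have hbound : ∀ N : ℕ, 0 < N → ‖((A ∩ Set.Icc 1 N).ncard : ℝ) / N - c m / m‖ ≤ m / N := by
    intro N hN
    rw [hc, Real.norm_eq_abs]
    have hN' : (0 : ℝ) < N := by exact_mod_cast hN
    have h1 : (c N : ℝ) = (N / m : ℕ) * c m + c (N % m) := by
      conv_lhs => rw [← Nat.div_add_mod N m, hmul]
      push_cast; ring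
    have h2 : (N : ℝ) = m * (N / m : ℕ) + (N % m : ℕ) := by
      exact_mod_cast (Nat.div_add_mod N m).symm
    have h3 : (c (N % m) : ℝ) ≤ m := by exact_mod_cast (hle _).trans (Nat.mod_lt _ hm).le
    have h4 : ((N % m : ℕ) : ℝ) * (c m / m) ≤ m := by
      have h5 : (c m : ℝ) / m ≤ 1 := (div_le_one hm').2 (by exact_mod_cast hle m)
      have h6 : ((N % m : ℕ) : ℝ) ≤ m := by exact_mod_cast (Nat.mod_lt _ hm).le
      calc ((N % m : ℕ) : ℝ) * (c m / m) ≤ m * 1 := by gcongr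
        _ = m := mul_one _
    have h7 : (c N : ℝ) / N - c m / m = (c (N % m) - (N % m : ℕ) * (c m / m)) / N := by
      rw [eq_div_iff hN'.ne', sub_mul, div_mul_cancel₀ _ hN'.ne', h1]
      rw [h2]
      field_simp
      ring
    rw [h7, abs_div, abs_of_pos hN']
    gcongr
    rw [abs_le]
    constructor <;> nlinarith [show (0 : ℝ) ≤ ((N % m : ℕ) : ℝ) * (c m / m) by positivity,
      show (0 : ℝ) ≤ c (N % m) by positivity]
  rw [HasNaturalDensity, tendsto_iff_norm_sub_tendsto_zero]
  refine squeeze_zero' (.of_forall fun _ => norm_nonneg _) ?_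
    (tendsto_const_div_atTop_nhds_zero_nat (m : ℝ))
  filter_upwards [eventually_gt_atTop 0] with N hN using hbound N hN

theorem freeNumbers_dvd_closed (B : Set ℕ) : ∀ n ∈ freeNumbers B, ∀ d, d ∣ n → d ∈ freeNumbers B :=
  fun _ hn _ hd => ⟨Nat.pos_of_dvd_of_pos hd hn.1, fun b hb hbd => hn.2 b hb (hbd.trans hd)⟩

theorem freeNumbers_anti {B B' : Set ℕ} (h : B ⊆ B') : freeNumbers B' ⊆ freeNumbers B :=
  fun _ hn => ⟨hn.1, fun b hb => hn.2 b (h hb)⟩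

theorem exists_hasNaturalDensity_freeNumbers {A : Set ℕ} (hA : A.Finite) (h0 : 0 ∉ A) :
    ∃ d, HasNaturalDensity (freeNumbers A) d := by
  refine exists_hasNaturalDensity_of_periodic (m := ∏ a ∈ hA.toFinset, a) ?_ fun n hn => ?_
  · refine Finset.prod_pos fun a ha => Nat.pos_of_ne_zero ?_
    rintro rfl
    exact h0 (hA.mem_toFinset.1 ha)
  · have key : ∀ b ∈ A, (b ∣ ∏ a ∈ hA.toFinset, a + n ↔ b ∣ n) := fun b hb =>
      Nat.dvd_add_right (Finset.dvd_prod_of_mem _ (hA.mem_toFinset.2 hb))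
    constructor
    · exact fun h => ⟨hn, fun b hb hd => h.2 b hb ((key b hb).2 hd)⟩
    · exact fun h => ⟨by omega, fun b hb hd => h.2 b hb ((key b hb).1 hd)⟩

/-! ### Truncation of a Behrend set -/

/-- The special case of the Davenport-Erdős theorem for sets of multiples of density one. -/
theorem exists_truncation_density_lt {B : Set ℕ} (hB0 : 0 ∉ B)
    (hB : HasNaturalDensity (freeNumbers B) 0) {ε : ℝ} (hε : 0 < ε) :
    ∃ K : ℕ, ∃ d < ε, HasNaturalDensity (freeNumbers (B ∩ Set.Iic K)) d := by
  have hζ : Tendsto (fun s : ℝ => (s - 1) * dirichletSum Set.univ s) (𝓝[>] 1) (𝓝 1) := by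
    refine tendsto_sub_mul_tsum_nat_rpow.congr fun s => ?_
    simp [dirichletSum, Real.rpow_neg]
  -- One `s` with ratio to zeta below `ε` is fixed first; `K` is then chosen for this `s`.
  obtain ⟨s, hs, hlt⟩ : ∃ s : ℝ, 1 < s ∧
      dirichletSum (freeNumbers B) s < ε * dirichletSum Set.univ s := by
    have h1 : Tendsto (fun s : ℝ => (s - 1) * dirichletSum (freeNumbers B) s
        - ε * ((s - 1) * dirichletSum Set.univ s)) (𝓝[>] 1) (𝓝 (0 - ε * 1)) :=
      hB.tendsto_sub_mul_dirichletSum.sub (hζ.const_mul ε)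
    obtain ⟨s, h2, hs⟩ := ((h1.eventually_lt_const (u := 0) (by linarith)).and
      self_mem_nhdsWithin).exists
    have hs1 : (0 : ℝ) < s - 1 := sub_pos.2 hs
    refine ⟨s, hs, ?_⟩
    have h3 : (s - 1) * dirichletSum (freeNumbers B) s <
      (s - 1) * (ε * dirichletSum Set.univ s) := by linarith
    exact lt_of_mul_lt_mul_left h3 hs1.le
  have hlim : Tendsto (fun K : ℕ => dirichletSum (freeNumbers (B ∩ Set.Iic K)) s) atTop
      (𝓝 (dirichletSum (freeNumbers B) s)) := by
    refine tendsto_tsum_of_dominated_convergence (bound := fun n : ℕ => (n : ℝ) ^ (-s))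
      (Real.summable_nat_rpow.2 (by linarith)) (fun n => ?_) (.of_forall fun K n => ?_)
    · refine tendsto_const_nhds.congr' ?_
      filter_upwards [eventually_ge_atTop n] with K hK
      have : n ∈ freeNumbers B ↔ n ∈ freeNumbers (B ∩ Set.Iic K) := by
        refine ⟨fun h => freeNumbers_anti Set.inter_subset_left h, fun h => ⟨h.1, fun b hb hd => ?_⟩⟩
        exact h.2 b ⟨hb, (Nat.le_of_dvd h.1 hd).trans hK⟩ hd
      by_cases h : n ∈ freeNumbers B
      · rw [Set.indicator_of_mem h, Set.indicator_of_mem (this.1 h)]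
      · rw [Set.indicator_of_notMem h, Set.indicator_of_notMem (mt this.2 h)]
    · rw [Real.norm_of_nonneg (indicator_rpow_nonneg _ _ _)]
      exact Set.indicator_le_self' (fun _ _ => by positivity) _
  obtain ⟨K, hK⟩ := (hlim.eventually_lt_const hlt).exists
  obtain ⟨d, hd⟩ := exists_hasNaturalDensity_freeNumbers
    ((Set.finite_Iic K).inter_of_right B) (fun h => hB0 h.1)
  refine ⟨K, d, ?_, hd⟩
  -- Let `t → 1` from the right in the monotonicity inequality.
  have hmono : d * dirichletSum Set.univ s ≤ dirichletSum (freeNumbers (B ∩ Set.Iic K)) s * 1 := by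
    refine le_of_tendsto_of_tendsto (hd.tendsto_sub_mul_dirichletSum.mul_const _)
      (hζ.const_mul _) ?_
    filter_upwards [Ioc_mem_nhdsGT hs] with t ht
    have := mul_le_mul_of_nonneg_left
      (dirichletSum_mul_le (freeNumbers_dvd_closed (B ∩ Set.Iic K)) ht.1 ht.2)
      (sub_pos.2 ht.1).le
    linarith
  exact lt_of_mul_lt_mul_right (by linarith) (dirichletSum_nonneg Set.univ s)

/-! ### Behrend sets and their products -/

/-- Removing one element from a Behrend set leaves a Behrend set. -/
theorem IsBehrend.diff_singleton {B : Set ℕ} (hB : IsBehrend B) (b : ℕ) :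
    IsBehrend (B \ {b}) := by
  refine ⟨fun a ha => hB.one_lt a ha.1, ?_⟩
  by_cases hb : b ∈ B
  swap
  · rw [Set.sdiff_singleton_eq_self hb]
    exact hB.density_zero
  have hb1 := hB.one_lt b hb
  set G := freeNumbers (B \ {b}) with hG
  have hsub : G ⊆ freeNumbers B ∪ (b * ·) '' G := by
    intro n hn
    by_cases hbn : b ∣ n
    · obtain ⟨m, rfl⟩ := hbn
      exact .inr ⟨m, freeNumbers_dvd_closed _ _ hn _ (dvd_mul_left _ _), rfl⟩
    · refine .inl ⟨hn.1, fun a ha hd => ?_⟩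
      by_cases hab : a = b
      · exact hbn (hab ▸ hd)
      · exact hn.2 a ⟨ha, hab⟩ hd
  have hrec : ∀ N, (G ∩ Set.Icc 1 N).ncard ≤
      (freeNumbers B ∩ Set.Icc 1 N).ncard + (G ∩ Set.Icc 1 (N / b)).ncard := fun N =>
    (ncard_inter_Icc_mono hsub N).trans ((ncard_union_inter_Icc_le _ _ N).trans
      (Nat.add_le_add_left (ncard_image_mul_inter_Icc_le G (by omega) N) _))
  rw [hasNaturalDensity_zero_iff]
  intro ε hε
  obtain ⟨N₀, hN₀⟩ := eventually_atTop.1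
    (hasNaturalDensity_zero_iff.1 hB.density_zero (ε / 4) (by linarith))
  -- The bound reproduces itself: `b ≥ 2` gives `ε / 4 + (ε / 2) / b ≤ ε / 2`, while `N₀` absorbs
  -- small `N`.
  have hbound : ∀ N : ℕ, ((G ∩ Set.Icc 1 N).ncard : ℝ) ≤ ε / 2 * N + N₀ := by
    intro N
    induction N using Nat.strong_induction_on with
    | _ N ih =>
    rcases lt_or_ge N N₀ with h | h
    · have h1 : ((G ∩ Set.Icc 1 N).ncard : ℝ) ≤ N₀ := by
        exact_mod_cast (ncard_inter_Icc_le G N).trans h.le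
      have : 0 ≤ ε / 2 * N := by positivity
      linarith
    rcases N.eq_zero_or_pos with rfl | hN
    · simp
    have h1 := ih (N / b) (Nat.div_lt_self hN hb1)
    have h2 : ((N / b : ℕ) : ℝ) ≤ N / 2 := by
      rw [le_div_iff₀ two_pos]
      exact_mod_cast (Nat.mul_le_mul_left _ hb1).trans (Nat.div_mul_le_self N b)
    have h3 : ((G ∩ Set.Icc 1 N).ncard : ℝ) ≤
        (freeNumbers B ∩ Set.Icc 1 N).ncard + (G ∩ Set.Icc 1 (N / b)).ncard := by
      exact_mod_cast hrec N
    have h4 := hN₀ N h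
    have h5 := mul_le_mul_of_nonneg_left h2 (half_pos hε).le
    linarith
  have hlarge : ∀ᶠ N : ℕ in atTop, (N₀ : ℝ) ≤ ε / 2 * N :=
    (tendsto_natCast_atTop_atTop.const_mul_atTop (half_pos hε)).eventually_ge_atTop _
  filter_upwards [hlarge] with N hN
  linarith [hbound N]

theorem IsBehrend.distinctProducts {B : Set ℕ} (hB : IsBehrend B) :
    IsBehrend (distinctProducts B) := by
  refine ⟨?_, ?_⟩
  · rintro _ ⟨b, hb, c, hc, -, rfl⟩
    exact Nat.one_lt_mul_iff.2 ⟨(hB.one_lt b hb).trans' one_pos, (hB.one_lt c hc).trans' one_pos,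
      .inl (hB.one_lt b hb)⟩
  rw [hasNaturalDensity_zero_iff]
  intro ε hε
  obtain ⟨K, d, hd, hK⟩ := exists_truncation_density_lt
    (fun h => absurd (hB.one_lt 0 h) (by simp)) hB.density_zero (half_pos hε)
  let U : Set ℕ := ⋃ b ∈ B ∩ Set.Iic K, (b * ·) '' freeNumbers (B \ {b})
  have hU : HasNaturalDensity U 0 :=
    hasNaturalDensity_zero_biUnion ((Set.finite_Iic K).inter_of_right B) fun b hb =>
      (hB.diff_singleton b).density_zero.zero_image_mul ((hB.one_lt b hb.1).trans' one_pos)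
  have hsub : freeNumbers (_root_.distinctProducts B) ⊆ freeNumbers (B ∩ Set.Iic K) ∪ U := by
    intro n hn
    by_cases h : n ∈ freeNumbers (B ∩ Set.Iic K)
    · exact .inl h
    · obtain ⟨b, hb, m, rfl⟩ : ∃ b ∈ B ∩ Set.Iic K, b ∣ n := by
        by_contra! h'
        exact h ⟨hn.1, h'⟩
      refine .inr (Set.mem_biUnion hb ⟨m, ⟨Nat.pos_of_mul_pos_left hn.1, fun c hc hcm => ?_⟩, rfl⟩)
      exact hn.2 (b * c) ⟨b, hb.1, c, hc.1, fun h => hc.2 h.symm, rfl⟩ (Nat.mul_dvd_mul_left b hcm)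
  filter_upwards [hK.eventually_lt_const hd, hasNaturalDensity_zero_iff.1 hU _ (half_pos hε),
    eventually_gt_atTop 0] with N h1 h2 hN
  rw [div_lt_iff₀ (by exact_mod_cast hN)] at h1
  have h3 : ((freeNumbers (_root_.distinctProducts B) ∩ Set.Icc 1 N).ncard : ℝ) ≤
      (freeNumbers (B ∩ Set.Iic K) ∩ Set.Icc 1 N).ncard + (U ∩ Set.Icc 1 N).ncard := by
    exact_mod_cast (ncard_inter_Icc_mono hsub N).trans (ncard_union_inter_Icc_le _ _ N)
  linarith

/-! ### Primitive bases -/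

theorem isPrimitiveSet_primitiveBasis (A : Set ℕ) : IsPrimitiveSet (primitiveBasis A) :=
  fun a ha _ hb hab => hb.2 a ha.1 hab

theorem IsPrimitiveSet.primitiveBasis_eq {A : Set ℕ} (hA : IsPrimitiveSet A) :
    primitiveBasis A = A :=
  Set.Subset.antisymm (fun _ ha => ha.1) fun a ha => ⟨ha, fun b hb hba => hA b hb a ha hba⟩

theorem exists_mem_primitiveBasis_dvd {A : Set ℕ} {a : ℕ} (h0 : 0 < a) (ha : a ∈ A) :
    ∃ b ∈ primitiveBasis A, b ∣ a := by
  induction a using Nat.strong_induction_on with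
  | _ a ih =>
  by_cases h : a ∈ primitiveBasis A
  · exact ⟨a, h, dvd_rfl⟩
  · obtain ⟨b, hb, hba, hne⟩ : ∃ b ∈ A, b ∣ a ∧ b ≠ a := by
      by_contra! h'
      exact h ⟨ha, h'⟩
    obtain ⟨c, hc, hcb⟩ := ih b ((Nat.le_of_dvd h0 hba).lt_of_ne hne)
      (Nat.pos_of_dvd_of_pos hba h0) hb
    exact ⟨c, hc, hcb.trans hba⟩

theorem freeNumbers_primitiveBasis (A : Set ℕ) :
    freeNumbers (primitiveBasis A) = freeNumbers A := by
  refine Set.Subset.antisymm (fun n hn => ⟨hn.1, fun a ha han => ?_⟩)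
    (freeNumbers_anti fun _ ha => ha.1)
  obtain ⟨b, hb, hba⟩ := exists_mem_primitiveBasis_dvd (Nat.pos_of_dvd_of_pos han hn.1) ha
  exact hn.2 b hb (hba.trans han)

theorem IsBehrend.primitiveBasis {A : Set ℕ} (hA : IsBehrend A) : IsBehrend (primitiveBasis A) :=
  ⟨fun a ha => hA.one_lt a ha.1, by rw [freeNumbers_primitiveBasis]; exact hA.density_zero⟩

/-- An element of `B` dividing `b * c` must be `b` or `c`, otherwise it would be coprime to the
product. So a product dividing another has the same two factors. -/
theorem isPrimitiveSet_distinctProducts {B : Set ℕ} (h1 : ∀ b ∈ B, 1 < b)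
    (hB : B.Pairwise Nat.Coprime) : IsPrimitiveSet (distinctProducts B) := by
  have key : ∀ x ∈ B, ∀ b ∈ B, ∀ c ∈ B, x ∣ b * c → x = b ∨ x = c := by
    intro x hx b hb c hc hd
    by_contra! h
    have := Nat.Coprime.eq_one_of_dvd ((hB hx hb h.1).mul_right (hB hx hc h.2)) hd
    exact (h1 x hx).ne' this
  rintro _ ⟨b, hb, c, hc, hbc, rfl⟩ _ ⟨b', hb', c', hc', -, rfl⟩ hd
  rcases key b hb b' hb' c' hc' ((dvd_mul_right b c).trans hd) with rfl | rfl <;>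
    rcases key c hc _ hb' _ hc' ((dvd_mul_left c _).trans hd) with rfl | rfl
  · exact absurd rfl hbc
  · rfl
  · exact mul_comm _ _
  · exact absurd rfl hbc

theorem mainTheorem12 (B : Set ℕ) (hB : IsBehrend B) :
    IsPrimitiveSet (primitiveBasis (distinctProducts B)) ∧
      IsBehrend (primitiveBasis (distinctProducts B)) ∧
      (B.Pairwise Nat.Coprime →
        IsPrimitiveSet (distinctProducts B) ∧
          primitiveBasis (distinctProducts B) = distinctProducts B) :=
  ⟨isPrimitiveSet_primitiveBasis _, hB.distinctProducts.primitiveBasis, fun h =>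
    ⟨isPrimitiveSet_distinctProducts hB.one_lt h,
      (isPrimitiveSet_distinctProducts hB.one_lt h).primitiveBasis_eq⟩⟩
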